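/- Write $\operatorname{lg} x=\max\{1,\log_2 x\}$. A network is a connected undirected graph with $n$ nodes and diameter $D$, working in synchronous rounds. In the \emph{beep model}, in each round every node either beeps or is silent, and a silent node learns whether at least one of its neighbours beeps (a beeping node learns nothing). In the \emph{radio model with collision detection}, in each round every node either listens or transmits a packet of $k$ bits; a listening node receives the packet if exactly one of its neighbours transmits, detects a collision if two or more do, and perceives silence otherwise. All nodes run the same program, each with its own independent random bits, which include a uniformly random identifier of $\Theta(\log n)$ bits. The only knowledge that the nodes have about the network is estimates of $n$ and $D$ that are correct up to a constant factor $\kappa$. At round $0$ an arbitrary nonempty set of nodes is awake; the other nodes only listen, without running the program, until they hear a beep, or receive a packet or detect a collision. \textbf{Theorem.} For all constants $c$ and $\kappa\ge 1$ there is a constant $C$ such that, in the beep model, there is a randomized distributed algorithm with the following property. On every connected network with $n$ nodes and diameter $D$, for every nonempty set of initially awake nodes and all estimates of $n$ and $D$ that are correct up to the factor $\kappa$, with probability at least $1-n^{-c}$ there is a single node (the leader), whose identifier is shared by no other node, such that no node ever outputs an identifier other than the leader's, and all nodes have output the leader's identifier by round $$C\cdot\bigl(D+\operatorname{lg} n\cdot\operatorname{lg}\operatorname{lg}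 n\bigr)\cdot\min\Bigl\{\operatorname{lg}\operatorname{lg} n,\ \operatorname{lg}\frac nD\Bigr\}$$ (for $n=1$, where $D=0$, the minimum is read as $1$). The same holds, with the same $C$, in the radio model with collision detection, for packets of any number $k$ of bits (which may depend on the estimate of $n$). -/

import Mathlib

/-- A communication medium for synchronous rounds on a graph. In a round every node either listens
(`none`) or transmits a packet (`some p`); `observe G x v` is what `v` perceives when the choices of
all the nodes are given by `x`, and `wakes o` says whether the observation `o` wakes up a sleeping
node. -/
structure Medium where
  Packet : Type
  Obs : Type
  wakes : Obs → Bool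
  observe : {V : Type} → [Fintype V] → SimpleGraph V → (V → Option Packet) → V → Obs

open Classical in
/-- The beep model: a transmission is a content-free beep. A silent node learns whether at least
one of its neighbours beeps; a beeping node learns nothing. -/
noncomputable def beepMedium : Medium where
  Packet := Unit
  Obs := Bool
  wakes := id
  observe := fun G x v => decide (x v = none ∧ ∃ u, G.Adj v u ∧ x u ≠ none)

/-- What a node perceives in a radio network with collision detection. -/
inductive RadioObs (P : Type) where
  | silence : RadioObs P
  | packet (p : P) : RadioObs P
  | collision : RadioObs P

/-- Message receptions and detected collisions wake up a sleeping node, silence does not. -/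
def RadioObs.wakes {P : Type} : RadioObs P → Bool
  | .silence => false
  | .packet _ => true
  | .collision => true

open Classical in
/-- The radio network model with collision detection and packets of `k` bits: a listening node
receives the packet of its only transmitting neighbour if there is exactly one, detects a collision
if there are two or more, and perceives silence if there is none. A transmitting node learns
nothing. -/
noncomputable def radioMedium (k : ℕ) : Medium where
  Packet := Fin k → Bool
  Obs := RadioObs (Fin k → Bool)
  wakes := RadioObs.wakes
  observe := fun G x v =>
    if x v = none then
      match (G.neighborFinset v).toList.filterMap x with
      | [] => .silence
      | [p] => .packet p
      | _ => .collision
    else .silence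

/-- The private randomness of a node: an identifier of `b` random bits, and `r` further coins. -/
abbrev Seed (b r : ℕ) : Type := (Fin b → Bool) × (Fin r → Bool)

/-- The program that every node runs (nodes are anonymous apart from their private randomness).
`start` is the initial state of a node that wakes up spontaneously in round `0`, `wake` that of a
node woken up by an observation. In a round, a node in state `s` does `transmit s`, observes `o`
and moves to `next s o`. `output s` is the identifier that the node has output, if any. -/
structure Protocol (m : Medium) (b r : ℕ) where
  State : Type
  start : Seed b r → State
  wake : Seed b r → m.Obs → State
  transmit : State → Option m.Packet
  next : State → m.Obs → State
  output : State → Option (Fin b → Bool)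

namespace Protocol

variable {m : Medium} {b r : ℕ} {V : Type} [Fintype V]

open Classical in
/-- The states of the nodes after `t` rounds on the network `G`, when the nodes of `W` are those
awake at round `0` and `ω` is the randomness of the nodes. A sleeping node has state `none`; it
listens until it is woken up. -/
noncomputable def config (P : Protocol m b r) (G : SimpleGraph V) (W : Set V)
    (ω : V → Seed b r) : ℕ → V → Option P.State
  | 0, v => if v ∈ W then some (P.start (ω v)) else none
  | t + 1, v =>
    let o := m.observe G (fun u => (P.config G W ω t u).bind P.transmit) v
    match P.config G W ω t v with
    | some s => some (P.next s o)
    | none => if m.wakes o then some (P.wake (ω v) o) else none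

/-- The output of node `v` after `t` rounds. -/
noncomputable def outputAt (P : Protocol m b r) (G : SimpleGraph V) (W : Set V)
    (ω : V → Seed b r) (t : ℕ) (v : V) : Option (Fin b → Bool) :=
  (P.config G W ω t v).bind P.output

/-- In the execution with randomness `ω`, a leader is elected by time `T`: there is a node `l`, the
only one with its identifier, such that no node ever outputs anything but the identifier of `l`,
and every node has output it from time `T` on. -/
def ElectsLeaderBy (P : Protocol m b r) (G : SimpleGraph V) (W : Set V)
    (ω : V → Seed b r) (T : ℝ) : Prop :=
  ∃ l : V, (∀ v, (ω v).1 = (ω l).1 → v = l) ∧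
    (∀ (t : ℕ) (v : V) (i : Fin b → Bool), P.outputAt G W ω t v = some i → i = (ω l).1) ∧
    (∀ (t : ℕ) (v : V), T ≤ t → P.outputAt G W ω t v = some (ω l).1)

end Protocol

open Classical in
/-- The probability of an event under the uniform distribution on a finite sample space. -/
noncomputable def uniformProb {Ω : Type} [Fintype Ω] (E : Ω → Prop) : ℝ :=
  ((Finset.univ.filter E).card : ℝ) / (Fintype.card Ω : ℝ)

/-- A distributed algorithm: it knows the estimates `N` and `Δ` of the number of nodes and of the
diameter, and nothing else about the network. Identifiers have `Θ(log N)` bits. For the radio model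
the number of bits of a packet may depend on `N`, whence the family `m` of media. -/
structure DistributedAlgorithm (m : ℕ → Medium) where
  idFactor : ℕ
  idFactor_pos : 0 < idFactor
  coins : ℕ → ℕ → ℕ
  protocol : (N Δ : ℕ) → Protocol (m N) (idFactor * (Nat.log 2 N + 1)) (coins N Δ)

/-- The logarithm of asymptotic bounds, `max {1, log₂ x}`. -/
noncomputable def lg (x : ℝ) : ℝ := max 1 (Real.logb 2 x)

/-- `(D + log n log log n) · min {log log n, log (n / D)}`. -/
noncomputable def electionTime (n D : ℕ) : ℝ :=
  ((D : ℝ) + lg n * lg (lg n)) * min (lg (lg n)) (lg ((n : ℝ) / (D : ℝ)))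

/-- On every connected network, for every nonempty set `W` of nodes awake at round `0`, and for all
estimates of the number `n` of nodes and of the diameter `D` that are correct up to the factor `κ`,
the algorithm elects a leader by round `C · electionTime n D` with probability at least
`1 - 1 / n ^ c`. -/
def DistributedAlgorithm.SolvesLeaderElection {m : ℕ → Medium} (A : DistributedAlgorithm m)
    (c κ C : ℕ) : Prop :=
  ∀ (V : Type) [Fintype V] [DecidableEq V] (G : SimpleGraph V) (W : Set V) (N Δ : ℕ),
    G.Connected → W.Nonempty →
    Fintype.card V ≤ κ * N → N ≤ κ * Fintype.card V →
    G.diam ≤ κ * Δ → Δ ≤ κ * G.diam →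
    1 - 1 / (Fintype.card V : ℝ) ^ c ≤
      uniformProb (fun ω : V → Seed (A.idFactor * (Nat.log 2 N + 1)) (A.coins N Δ) =>
        (A.protocol N Δ).ElectsLeaderBy G W ω (C * electionTime (Fintype.card V) G.diam))

/-! The leader is the node with the lexicographically largest identifier. Identifiers are long
enough to be distinct with the required probability, so the rest of the argument is deterministic.

Every node keeps a tentative prefix of the maximum `m` and edits its end by at most one bit per
step: it discards a bit, raises a final 0 to 1, or appends a bit once all neighbours have caught up.
The invariant `Coherent` says that neighbouring lengths differ by at most 2, that an estimate never
exceeds `m` at the first position where they may differ, and that a node reaches beyond a correct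
prefix only if its neighbours hold that prefix too. Hence correct bits are never lost. Bits and
distance are pipelined: by `agrees_or_short`, a node at distance `d` from the leader has `i` correct
bits after `3 i + 2 d` steps. The proof bounds length plus time, so that overlong wrong estimates
are withdrawn in time.

By the bound on the lengths, a step needs only the length modulo 5 and the last five bits of each
neighbour (`advanceHeard_eq`). There are constantly many such codes, and a node can announce its own
by making noise in the round reserved for that code. Clocks of neighbours differ by at most one,
which reserving three rounds absorbs (`replay_hearing`). Only the presence of noise is used, so
beeps and radio with collision detection are treated alike.

Altogether O(D + lg n) rounds suffice; this is at most the stated bound, whose additional factors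
are all at least 1. -/

/-- A finite bit string: only the first `len` values of `bit` matter. -/
structure BitPrefix where
  len : ℕ
  bit : ℕ → Bool

/-! ### The local rule for editing an estimate. -/

namespace BitPrefix

/-- The last bit of `s` has to be discarded: some neighbour is far behind, or contradicts the last
bit but one of `s` by a larger bit. -/
def MustPop (s : BitPrefix) (N : Set BitPrefix) : Prop :=
  ∃ u ∈ N, u.len + 2 ≤ s.len ∨
    (u.len + 1 = s.len ∧ 2 ≤ s.len ∧ u.bit (s.len - 2) = true ∧ s.bit (s.len - 2) = false)

/-- The last bit of `s` is `0`, whereas some neighbour has a `1` there. -/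
def MustRaise (s : BitPrefix) (N : Set BitPrefix) : Prop :=
  1 ≤ s.len ∧ s.bit (s.len - 1) = false ∧ ∃ u ∈ N, s.len ≤ u.len ∧ u.bit (s.len - 1) = true

/-- `s` is a prefix of `a`. -/
def IsPrefixOf (s : BitPrefix) (a : ℕ → Bool) : Prop := ∀ j < s.len, s.bit j = a j

/-- All neighbours have caught up with `s`, and there is a bit to extend `s` by. -/
def MayExtend (a : ℕ → Bool) (s : BitPrefix) (N : Set BitPrefix) : Prop :=
  (∀ u ∈ N, s.len ≤ u.len ∧ (1 ≤ s.len → u.bit (s.len - 1) = s.bit (s.len - 1))) ∧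
    (s.IsPrefixOf a ∨ ∃ u ∈ N, s.len < u.len)

/-- The bit by which `s` is extended is `1`. -/
def NextBit (a : ℕ → Bool) (s : BitPrefix) (N : Set BitPrefix) : Prop :=
  (s.IsPrefixOf a ∧ a s.len = true) ∨ ∃ u ∈ N, s.len < u.len ∧ u.bit s.len = true

open Classical in
/-- One step of a node with identifier `a` and estimate `s`, when `N` is the set of the estimates of
its neighbours. -/
noncomputable def advance (a : ℕ → Bool) (s : BitPrefix) (N : Set BitPrefix) : BitPrefix :=
  if s.MustPop N then ⟨s.len - 1, s.bit⟩
  else if s.MustRaise N then ⟨s.len, Function.update s.bit (s.len - 1) true⟩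
  else if s.MayExtend a N then
    ⟨s.len + 1, Function.update s.bit s.len (decide (s.NextBit a N))⟩
  else s

/-- The first `i` bits of `s` exist and are those of `m`. -/
def Agrees (m : ℕ → Bool) (i : ℕ) (s : BitPrefix) : Prop :=
  i ≤ s.len ∧ ∀ j < i, s.bit j = m j

theorem advance_cases (a : ℕ → Bool) (s : BitPrefix) (N : Set BitPrefix) :
    (s.MustPop N ∧ (s.advance a N).len = s.len - 1 ∧ (s.advance a N).bit = s.bit) ∨
    (¬ s.MustPop N ∧ s.MustRaise N ∧ (s.advance a N).len = s.len ∧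
      (s.advance a N).bit (s.len - 1) = true ∧
      ∀ j, j < s.len - 1 → (s.advance a N).bit j = s.bit j) ∨
    (¬ s.MustPop N ∧ ¬ s.MustRaise N ∧ s.MayExtend a N ∧ (s.advance a N).len = s.len + 1 ∧
      ((s.advance a N).bit s.len = true ↔ s.NextBit a N) ∧
      ∀ j, j < s.len → (s.advance a N).bit j = s.bit j) ∨
    (¬ s.MustPop N ∧ ¬ s.MustRaise N ∧ ¬ s.MayExtend a N ∧ s.advance a N = s) := by
  by_cases h1 : s.MustPop N
  · exact Or.inl ⟨h1, by simp [advance, h1], by simp [advance, h1]⟩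
  by_cases h2 : s.MustRaise N
  · refine Or.inr (Or.inl ⟨h1, h2, by simp [advance, h1, h2], by simp [advance, h1, h2], ?_⟩)
    intro j hj
    simp [advance, h1, h2, Function.update_of_ne hj.ne]
  by_cases h3 : s.MayExtend a N
  · refine Or.inr (Or.inr (Or.inl ⟨h1, h2, h3, by simp [advance, h1, h2, h3],
      by simp [advance, h1, h2, h3], ?_⟩))
    intro j hj
    simp [advance, h1, h2, h3, Function.update_of_ne hj.ne]
  · exact Or.inr (Or.inr (Or.inr ⟨h1, h2, h3, by simp [advance, h1, h2, h3]⟩))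

end BitPrefix

open BitPrefix

/-! ### The synchronous process and its invariant. -/

section Estimates

variable {V : Type}

theorem SimpleGraph.Connected.exists_adj_dist_add_one_eq {G : SimpleGraph V} (hG : G.Connected)
    {v l : V} (hd : 0 < G.dist v l) : ∃ u, G.Adj v u ∧ G.dist u l + 1 = G.dist v l := by
  obtain ⟨p, hp⟩ := hG.exists_walk_length_eq_dist v l
  cases p with
  | nil => simp at hd
  | @cons _ u _ hu p =>
    refine ⟨u, hu, le_antisymm ?_ ?_⟩
    · rw [← hp, SimpleGraph.Walk.length_cons]
      exact Nat.add_le_add_right (SimpleGraph.dist_le p) 1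
    · have := hG.dist_triangle (u := v) (v := u) (w := l)
      rw [SimpleGraph.dist_eq_one_iff_adj.2 hu] at this
      omega

/-- One synchronous step of all the nodes of the network `G` with identifiers `a`. -/
noncomputable def advanceAll (G : SimpleGraph V) (a : V → ℕ → Bool) (X : V → BitPrefix) (v : V) :
    BitPrefix :=
  (X v).advance (a v) (X '' G.neighborSet v)

/-- The estimates of the nodes after `t` synchronous steps. -/
noncomputable def estimate (G : SimpleGraph V) (a : V → ℕ → Bool) : ℕ → V → BitPrefix
  | 0, _ => ⟨0, fun _ => false⟩
  | t + 1, v => advanceAll G a (estimate G a t) v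

/-- The invariant of the process: `m` is the lexicographically largest identifier. -/
structure Coherent (G : SimpleGraph V) (m : ℕ → Bool) (X : V → BitPrefix) : Prop where
  lipschitz : ∀ u v, G.Adj u v → (X u).len ≤ (X v).len + 2
  le_max : ∀ v i, Agrees m i (X v) → i < (X v).len → (X v).bit i = true → m i = true
  closed : ∀ v u i, G.Adj v u → Agrees m i (X v) → i < (X v).len → Agrees m i (X u)

/-- No identifier is lexicographically larger than `m`. -/
def IsLexUpperBound (a : V → ℕ → Bool) (m : ℕ → Bool) : Prop :=
  ∀ v i, (∀ j < i, a v j = m j) → a v i = true → m i = true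

namespace Coherent

variable {G : SimpleGraph V} {a : V → ℕ → Bool} {m : ℕ → Bool} {X : V → BitPrefix}

/-- The field `closed` yields agreement of the neighbour on all bits but the last. This is why the
rule for extending need only compare the last bit. -/
theorem agrees_of_mayExtend (h : Coherent G m X) {v u : V} (huv : G.Adj v u)
    (hext : (X v).MayExtend (a v) (X '' G.neighborSet v)) (hv : Agrees m (X v).len (X v)) :
    Agrees m (X v).len (X u) := by
  obtain ⟨hlen, hbit⟩ := hext.1 (X u) ⟨u, huv, rfl⟩
  refine ⟨hlen, fun j hj => ?_⟩
  rcases Nat.lt_or_ge j ((X v).len - 1) with hj' | hj'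
  · have := h.closed v u ((X v).len - 1) huv ⟨by omega, fun k hk => hv.2 k (by omega)⟩ (by omega)
    exact this.2 j hj'
  · obtain rfl : j = (X v).len - 1 := by omega
    rw [hbit (by omega)]
    exact hv.2 _ hj

/-- The new 1 comes either from the node's own identifier, which is bounded by `m`, or from a longer
neighbour that agrees with `m` so far, to which `le_max` applies. -/
theorem eq_true_of_nextBit (h : Coherent G m X) (hm : IsLexUpperBound a m) {v : V}
    (hext : (X v).MayExtend (a v) (X '' G.neighborSet v)) (hv : Agrees m (X v).len (X v))
    (hb : (X v).NextBit (a v) (X '' G.neighborSet v)) : m (X v).len = true := by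
  rcases hb with ⟨hp, hb⟩ | ⟨_, ⟨u, hu, rfl⟩, hlen, hb⟩
  · exact hm v _ (fun j hj => by rw [← hp j hj, hv.2 j hj]) hb
  · exact h.le_max u _ (h.agrees_of_mayExtend hu hext hv) hlen hb

theorem eq_true_of_mustRaise (h : Coherent G m X) {v : V}
    (hr : (X v).MustRaise (X '' G.neighborSet v)) (hv : Agrees m ((X v).len - 1) (X v)) :
    m ((X v).len - 1) = true := by
  obtain ⟨h1, _, _, ⟨u, hu, rfl⟩, hlen, hb⟩ := hr
  exact h.le_max u _ (h.closed v u _ hu hv (by omega)) (by omega) hb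

/-- Correct bits survive. Discarding one would need a neighbour that is too short or contradicts an
earlier bit, which `closed` excludes; a bit is only raised where `m` has a 1. -/
theorem agrees_advanceAll (h : Coherent G m X) {v : V} {i : ℕ} (hv : Agrees m i (X v)) :
    Agrees m i (advanceAll G a X v) := by
  obtain ⟨hi, hb⟩ := hv
  rcases advance_cases (a v) (X v) (X '' G.neighborSet v) with
    ⟨hp, hl, hbit⟩ | ⟨_, hr, hl, hlast, hbit⟩ | ⟨_, _, _, hl, _, hbit⟩ | ⟨_, _, _, he⟩
  · refine ⟨?_, fun j hj => by rw [advanceAll, hbit, hb j hj]⟩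
    rw [advanceAll, hl]
    by_contra hlt
    obtain rfl : i = (X v).len := by omega
    obtain ⟨_, ⟨u, hu, rfl⟩, hu'⟩ := hp
    have hag := h.closed v u ((X v).len - 1) hu ⟨by omega, fun k hk => hb k (by omega)⟩ (by omega)
    have := hag.1
    rcases hu' with hu' | ⟨h1, h2, h3, h4⟩
    · omega
    · rw [hb _ (by omega), ← hag.2 _ (by omega), h3] at h4
      exact absurd h4 (by simp)
  · refine ⟨by rw [advanceAll, hl]; exact hi, fun j hj => ?_⟩
    rcases Nat.lt_or_ge j ((X v).len - 1) with hj' | hj'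
    · rw [advanceAll, hbit j hj', hb j hj]
    · obtain rfl : j = (X v).len - 1 := by omega
      rw [advanceAll, hlast, h.eq_true_of_mustRaise hr ⟨by omega, fun k hk => hb k (by omega)⟩]
  · exact ⟨by rw [advanceAll, hl]; omega, fun j hj => by
      rw [advanceAll, hbit j (by omega), hb j hj]⟩
  · rw [advanceAll, he]
    exact ⟨hi, hb⟩

/-- A length drops by at most 1 per step. A node 2 ahead of a neighbour must pop, and one that is
ahead at all cannot extend, so the gap never exceeds 2. For `closed`, only an extension creates a
new obligation, and `agrees_of_mayExtend` meets it. -/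
theorem advanceAll (h : Coherent G m X) (hm : IsLexUpperBound a m) :
    Coherent G m (advanceAll G a X) := by
  refine ⟨fun u v huv => ?_, fun v i hv hi hb => ?_, fun v u i huv hv hi => ?_⟩
  · have h2 := h.lipschitz u v huv
    have hpop : (X v).len + 2 ≤ (X u).len → (X u).MustPop (X '' G.neighborSet u) :=
      fun hle => ⟨X v, ⟨v, huv, rfl⟩, Or.inl hle⟩
    have hext : (X u).MayExtend (a u) (X '' G.neighborSet u) → (X u).len ≤ (X v).len :=
      fun hx => (hx.1 (X v) ⟨v, huv, rfl⟩).1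
    have hv : (X v).len - 1 ≤ (_root_.advanceAll G a X v).len := by
      rw [_root_.advanceAll]
      rcases advance_cases (a v) (X v) (X '' G.neighborSet v) with
        ⟨_, hl, _⟩ | ⟨_, _, hl, _⟩ | ⟨_, _, _, hl, _⟩ | ⟨_, _, _, he⟩
      · omega
      · omega
      · omega
      · rw [he]; omega
    rw [_root_.advanceAll]
    rcases advance_cases (a u) (X u) (X '' G.neighborSet u) with
      ⟨_, hl, _⟩ | ⟨hp, _, hl, _⟩ | ⟨_, _, hx, hl, _⟩ | ⟨hp, _, _, he⟩
    · omega
    · have : ¬ _ := fun hle => hp (hpop hle)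
      omega
    · have := hext hx
      omega
    · have : ¬ _ := fun hle => hp (hpop hle)
      rw [he]; omega
  · rw [_root_.advanceAll] at hv hi hb
    rcases advance_cases (a v) (X v) (X '' G.neighborSet v) with
      ⟨hp, hl, hbit⟩ | ⟨_, hr, hl, hlast, hbit⟩ | ⟨_, _, hx, hl, hnext, hbit⟩ | ⟨_, _, _, he⟩
    · rw [hbit] at hb
      exact h.le_max v i ⟨by omega, fun j hj => by rw [← hv.2 j hj, hbit]⟩ (by omega) hb
    · have hag : Agrees m i (X v) :=
        ⟨by omega, fun j hj => by rw [← hv.2 j hj, hbit j (by omega)]⟩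
      rcases Nat.lt_or_ge i ((X v).len - 1) with hi' | hi'
      · rw [hbit i hi'] at hb
        exact h.le_max v i hag (by omega) hb
      · obtain rfl : i = (X v).len - 1 := by omega
        exact h.eq_true_of_mustRaise hr hag
    · have hag : Agrees m i (X v) :=
        ⟨by omega, fun j hj => by rw [← hv.2 j hj, hbit j (by omega)]⟩
      rcases Nat.lt_or_ge i (X v).len with hi' | hi'
      · rw [hbit i hi'] at hb
        exact h.le_max v i hag hi' hb
      · obtain rfl : i = (X v).len := by omega
        exact h.eq_true_of_nextBit hm hx hag (hnext.1 hb)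
    · rw [he] at hv hi hb
      exact h.le_max v i hv hi hb
  · apply h.agrees_advanceAll
    rw [_root_.advanceAll] at hv hi
    rcases advance_cases (a v) (X v) (X '' G.neighborSet v) with
      ⟨hp, hl, hbit⟩ | ⟨_, hr, hl, hlast, hbit⟩ | ⟨_, _, hx, hl, hnext, hbit⟩ | ⟨_, _, _, he⟩
    · exact h.closed v u i huv ⟨by omega, fun j hj => by rw [← hv.2 j hj, hbit]⟩ (by omega)
    · exact h.closed v u i huv
        ⟨by omega, fun j hj => by rw [← hv.2 j hj, hbit j (by omega)]⟩ (by omega)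
    · have hag : Agrees m i (X v) :=
        ⟨by omega, fun j hj => by rw [← hv.2 j hj, hbit j (by omega)]⟩
      rcases Nat.lt_or_ge i (X v).len with hi' | hi'
      · exact h.closed v u i huv hag hi'
      · obtain rfl : i = (X v).len := by omega
        exact h.agrees_of_mayExtend huv hx hag
    · rw [he] at hv hi
      exact h.closed v u i huv hv hi

/-- A node whose identifier is the maximum always holds a prefix of it. -/
theorem agrees_len_advanceAll (h : Coherent G m X) (hm : IsLexUpperBound a m) {l : V}
    (hl : a l = m) (hX : Agrees m (X l).len (X l)) :
    Agrees m (_root_.advanceAll G a X l).len (_root_.advanceAll G a X l) := by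
  have hkeep := h.agrees_advanceAll (a := a) hX
  refine ⟨le_rfl, fun j hj => ?_⟩
  rw [_root_.advanceAll] at hj hkeep ⊢
  rcases Nat.lt_or_ge j (X l).len with hj' | hj'
  · exact hkeep.2 j hj'
  rcases advance_cases (a l) (X l) (X '' G.neighborSet l) with
      ⟨hp, hl, hbit⟩ | ⟨_, hr, hl, hlast, hbit⟩ | ⟨_, _, hx, hlen, hnext, hbit⟩ | ⟨_, _, _, he⟩
  · omega
  · omega
  · obtain rfl : j = (X l).len := by omega
    rw [Bool.eq_iff_iff, hnext]
    refine ⟨h.eq_true_of_nextBit hm hx hX, fun hb => Or.inl ⟨fun k hk => ?_, by rw [hl, hb]⟩⟩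
    rw [hX.2 k hk, hl]
  · rw [he] at hj
    omega

end Coherent

/-! ### Convergence to the maximal identifier. -/

variable {G : SimpleGraph V} {a : V → ℕ → Bool} {m : ℕ → Bool}

theorem coherent_estimate (G : SimpleGraph V) (hm : IsLexUpperBound a m) (t : ℕ) :
    Coherent G m (estimate G a t) := by
  induction t with
  | zero =>
    refine ⟨fun u v _ => by simp [estimate], fun v i _ hi => ?_, fun v u i _ _ hi => ?_⟩ <;>
      exact absurd hi (Nat.not_lt_zero i)
  | succ t ih => exact ih.advanceAll hm

theorem agrees_len_estimate (G : SimpleGraph V) (hm : IsLexUpperBound a m) {l : V} (hl : a l = m)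
    (t : ℕ) : Agrees m (estimate G a t l).len (estimate G a t l) := by
  induction t with
  | zero => exact ⟨le_rfl, fun j hj => absurd hj (Nat.not_lt_zero j)⟩
  | succ t ih => exact (coherent_estimate G hm t).agrees_len_advanceAll hm hl ih

/-- A neighbour `v` of a node `u` that agrees with `m` on `i + 1` bits agrees with `m` on `i` bits; if
it does not agree on the next bit, then `u` waits, and `v` has a `0` there, if anything. -/
theorem Coherent.agrees_and_bit_of_adj {X : V → BitPrefix} (h : Coherent G m X) {v u : V} {i : ℕ}
    (huv : G.Adj v u) (hu : Agrees m (i + 1) (X u)) (hv : ¬ Agrees m (i + 1) (X v)) :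
    Agrees m i (X v) ∧ m i = (X u).bit i ∧ (X u).len = i + 1 ∧
      (i + 1 ≤ (X v).len → (X v).bit i = false ∧ m i = true) := by
  have hlen : (X u).len = i + 1 := by
    by_contra hne
    exact hv (h.closed u v (i + 1) huv.symm hu (by have := hu.1; omega))
  have hvi : Agrees m i (X v) :=
    h.closed u v i huv.symm ⟨by omega, fun j hj => hu.2 j (by omega)⟩ (by omega)
  refine ⟨hvi, (hu.2 i (by omega)).symm, hlen, fun hle => ?_⟩
  have hne : (X v).bit i ≠ m i := fun he => hv ⟨hle, fun j hj => by
    rcases Nat.lt_or_ge j i with hj' | hj'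
    · exact hvi.2 j hj'
    · obtain rfl : j = i := by omega
      exact he⟩
  have hmax := h.le_max v i hvi (by omega)
  cases hb : (X v).bit i <;> cases hc : m i <;> simp_all

/-- Node `v` agrees with the maximal identifier on the first `i` bits after `3 i + 2 d` steps, where
`d` is the distance to the node that has it; before that, its estimate is not too long, so that it
can be withdrawn in time. -/
theorem agrees_or_short (hG : G.Connected) (hm : IsLexUpperBound a m) {l : V} (hl : a l = m)
    (t : ℕ) : ∀ (v : V) (i : ℕ), Agrees m i (estimate G a t v) ∨
      (t ≤ 3 * i + 2 * G.dist l v ∧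
        (estimate G a t v).len + t ≤ i + 3 * i + 2 * G.dist l v) := by
  induction t with
  | zero => exact fun v i => Or.inr ⟨Nat.zero_le _, by simp [estimate]⟩
  | succ t ih =>
    intro v i
    have h := coherent_estimate G hm t
    have hlead := agrees_len_estimate G hm hl t
    have hlead' := agrees_len_estimate G hm hl (t + 1)
    rcases i with _ | i
    · exact Or.inl ⟨Nat.zero_le _, fun j hj => absurd hj (Nat.not_lt_zero j)⟩
    by_cases hv : Agrees m (i + 1) (estimate G a t v)
    · exact Or.inl (h.agrees_advanceAll hv)
    obtain ⟨hB, hlen⟩ := (ih v (i + 1)).resolve_left hv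
    by_cases hv' : Agrees m (i + 1) (estimate G a (t + 1) v)
    · exact Or.inl hv'
    right
    generalize hX : estimate G a t = X at *
    have hcases : estimate G a (t + 1) v = (X v).advance (a v) (X '' G.neighborSet v) := by
      rw [estimate, hX, advanceAll]
    have hnbr : ∀ u, G.Adj v u → G.dist l u ≤ G.dist l v + 1 := fun u hu => by
      have := hG.dist_triangle (u := l) (v := v) (w := u)
      rwa [SimpleGraph.dist_eq_one_iff_adj.2 hu] at this
    -- At the deadline for `i + 1` bits, the deadlines for `i` bits have passed at `v` and at all
    -- its neighbours: the latest of them is `3 i + 2 (d + 1)`, one step earlier.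
    have hnear : t = 3 * (i + 1) + 2 * G.dist l v →
        Agrees m i (X v) ∧ ∀ u, G.Adj v u → Agrees m i (X u) := by
      intro ht
      refine ⟨(ih v i).resolve_right (by omega), fun u hu => (ih u i).resolve_right ?_⟩
      have := hnbr u hu
      omega
    have hnopop : t = 3 * (i + 1) + 2 * G.dist l v →
        ¬ (X v).MustPop (X '' G.neighborSet v) := by
      rintro ht ⟨_, ⟨u, hu, rfl⟩, hp⟩
      have h1 := ((hnear ht).2 u hu).1
      rcases hp with hp | ⟨hp, h2, h3, h4⟩
      · omega
      · rw [(hnear ht).1.2 _ (by omega), ← ((hnear ht).2 u hu).2 _ (by omega), h3] at h4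
        exact absurd h4 (by simp)
    have hallext : t = 3 * (i + 1) + 2 * G.dist l v → (X v).len = i →
        ∀ u ∈ X '' G.neighborSet v, (X v).len ≤ u.len ∧
          (1 ≤ (X v).len → u.bit ((X v).len - 1) = (X v).bit ((X v).len - 1)) := by
      rintro ht hi _ ⟨u, hu, rfl⟩
      have h1 := (hnear ht).2 u hu
      refine ⟨by rw [hi]; exact h1.1, fun hpos => ?_⟩
      rw [h1.2 _ (by omega), (hnear ht).1.2 _ (by omega)]
    -- The leader always holds a prefix of `m`, so it can only be too short. Any other node is
    -- compared with a neighbour `u` closer to the leader.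
    rcases Nat.eq_zero_or_pos (G.dist l v) with hd | hd
    · obtain rfl : l = v := hG.dist_eq_zero_iff.1 hd
      have hlt : (X l).len < i + 1 := by
        by_contra hle
        exact hv ⟨by omega, fun j hj => hlead.2 j (by omega)⟩
      have hlt' : (estimate G a (t + 1) l).len < i + 1 := by
        by_contra hle
        exact hv' ⟨by omega, fun j hj => hlead'.2 j (by omega)⟩
      refine ⟨?_, by omega⟩
      by_contra ht
      replace ht : t = 3 * (i + 1) + 2 * G.dist l l := by omega
      have hi : (X l).len = i := by have := (hnear ht).1.1; omega
      have hext : (X l).MayExtend (a l) (X '' G.neighborSet l) :=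
        ⟨hallext ht hi, Or.inl fun j hj => by rw [hlead.2 j hj, hl]⟩
      rw [hcases] at hlt'
      rcases advance_cases (a l) (X l) (X '' G.neighborSet l) with
        ⟨hp, _⟩ | ⟨_, hr, _⟩ | ⟨_, _, _, hlen', _⟩ | ⟨_, _, hx, _⟩
      · exact hnopop ht hp
      · have hm1 := h.eq_true_of_mustRaise hr ⟨by omega, fun j hj => hlead.2 j (by omega)⟩
        have h0 := hr.1
        have h2 := hr.2.1
        rw [hlead.2 _ (by omega), hm1] at h2
        exact absurd h2 (by simp)
      · omega
      · exact hx hext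
    · obtain ⟨u, hvu, hdu⟩ : ∃ u, G.Adj v u ∧ G.dist l u + 1 = G.dist l v := by
        rw [SimpleGraph.dist_comm] at hd
        simpa only [G.dist_comm (v := l)] using hG.exists_adj_dist_add_one_eq hd
      by_cases hu : Agrees m (i + 1) (X u)
      · obtain ⟨hvi, hmi, hul, hbad⟩ := h.agrees_and_bit_of_adj hvu hu hv
        rw [hcases] at hv' ⊢
        rcases Nat.lt_or_ge (i + 1) (X v).len with hlt | hge
        · have hp : (X v).MustPop (X '' G.neighborSet v) := by
            refine ⟨X u, ⟨u, hvu, rfl⟩, ?_⟩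
            rcases Nat.lt_or_ge (i + 2) (X v).len with h3 | h3
            · exact Or.inl (by omega)
            · obtain ⟨h4, h5⟩ := hbad (by omega)
              have h6 : (X v).len - 2 = i := by omega
              exact Or.inr ⟨by omega, by omega, by rw [h6, ← hmi, h5], by rw [h6, h4]⟩
          rcases advance_cases (a v) (X v) (X '' G.neighborSet v) with
            ⟨_, hl', _⟩ | ⟨hn, _⟩ | ⟨hn, _⟩ | ⟨hn, _⟩
          · omega
          · exact absurd hp hn
          · exact absurd hp hn
          · exact absurd hp hn
        rcases Nat.lt_or_ge (X v).len (i + 1) with hlt | hge'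
        · have hi : (X v).len = i := by have := hvi.1; omega
          rcases advance_cases (a v) (X v) (X '' G.neighborSet v) with
            ⟨hp, hl', _⟩ | ⟨_, hr, hl', _⟩ | ⟨_, _, hx, hl', hnb, hbit⟩ | ⟨hp, hr, hx, he⟩
          · have : ¬ _ := fun ht => hnopop ht hp
            omega
          · exfalso
            have h0 := hr.1
            have hm1 := h.eq_true_of_mustRaise hr ⟨by omega, fun j hj => hvi.2 j (by omega)⟩
            have h2 := hr.2.1
            rw [hvi.2 _ (by omega), hm1] at h2
            exact absurd h2 (by simp)
          · exfalso
            refine hv' ⟨by omega, fun j hj => ?_⟩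
            rcases Nat.lt_or_ge j i with hj' | hj'
            · rw [hbit j (by omega), hvi.2 j hj']
            · obtain rfl : j = i := by omega
              have hnb' := hnb
              rw [hi] at hnb'
              rw [Bool.eq_iff_iff, hnb']
              have hv2 : Agrees m (X v).len (X v) := by rw [hi]; exact hvi
              refine ⟨fun hb => ?_, fun hb => Or.inr ⟨X u, ⟨u, hvu, rfl⟩, by omega, ?_⟩⟩
              · have := h.eq_true_of_nextBit hm hx hv2 hb
                rwa [hi] at this
              · rw [hi, ← hmi, hb]
          · have : ¬ _ := fun ht => hx ⟨hallext ht hi, Or.inr ⟨X u, ⟨u, hvu, rfl⟩, by omega⟩⟩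
            rw [he]
            omega
        · have hi : (X v).len = i + 1 := by omega
          have hi' : (X v).len - 1 = i := by omega
          obtain ⟨h4, h5⟩ := hbad hge'
          have hr : (X v).MustRaise (X '' G.neighborSet v) :=
            ⟨by omega, by rw [hi', h4], X u, ⟨u, hvu, rfl⟩, by omega, by rw [hi', ← hmi, h5]⟩
          rcases advance_cases (a v) (X v) (X '' G.neighborSet v) with
            ⟨hp, hl', _⟩ | ⟨_, _, hl', hlast, hbit⟩ | ⟨_, hn, _⟩ | ⟨_, hn, _⟩
          · have : ¬ _ := fun ht => hnopop ht hp
            omega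
          · exfalso
            refine hv' ⟨by omega, fun j hj => ?_⟩
            rcases Nat.lt_or_ge j i with hj' | hj'
            · rw [hbit j (by omega), hvi.2 j hj']
            · obtain rfl : j = i := by omega
              rw [← hi', hlast, hi', h5]
          · exact absurd hr hn
          · exact absurd hr hn
      -- Both bounds for `u` are smaller by 2. Unless `v` pops, its new length is at most one more
      -- than the old length of `u`; this and the elapsed step use up the 2.
      · obtain ⟨hB', hlen'⟩ := (ih u (i + 1)).resolve_left hu
        refine ⟨by omega, ?_⟩
        rw [hcases]
        rcases advance_cases (a v) (X v) (X '' G.neighborSet v) with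
          ⟨hp, hl', _⟩ | ⟨hp, _, hl', _⟩ | ⟨_, _, hx, hl', _⟩ | ⟨hp, _, _, he⟩
        · omega
        · have : ¬ _ := fun hle => hp ⟨X u, ⟨u, hvu, rfl⟩, Or.inl hle⟩
          omega
        · have := (hx.1 _ ⟨u, hvu, rfl⟩).1
          omega
        · have : ¬ _ := fun hle => hp ⟨X u, ⟨u, hvu, rfl⟩, Or.inl hle⟩
          rw [he]
          omega

end Estimates

/-! ### Finite codes that suffice for a step. -/

namespace BitPrefix

/-- What a node makes public about its estimate: the length modulo `5`, and the last five bits,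
indexed by their positions modulo `5`. -/
abbrev Code : Type := Fin 5 × (Fin 5 → Bool)

open Classical in
/-- The public part of an estimate. -/
noncomputable def code (s : BitPrefix) : Code :=
  (⟨s.len % 5, Nat.mod_lt _ (by norm_num)⟩, fun r =>
    decide (∃ j, j < s.len ∧ s.len ≤ j + 5 ∧ j % 5 = r ∧ s.bit j = true))

/-- The number that is congruent to `r` modulo `5` and differs from `n` by at most `2`. -/
def nearbyLength (n r : ℕ) : ℕ :=
  if r = n % 5 then n else if r = (n + 1) % 5 then n + 1 else if r = (n + 2) % 5 then n + 2
  else if r = (n + 4) % 5 then n - 1 else n - 2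

/-- What a node with an estimate of length `n` reconstructs from the code of a neighbour. -/
def decode (n : ℕ) (c : Code) : BitPrefix :=
  ⟨nearbyLength n c.1, fun j => c.2 ⟨j % 5, Nat.mod_lt _ (by norm_num)⟩⟩

/-- One step, when the codes of the neighbours are heard; the node's own code is ignored. -/
noncomputable def advanceHeard (a : ℕ → Bool) (s : BitPrefix) (O : Set Code) : BitPrefix :=
  s.advance a (decode s.len '' {c | c ∈ O ∧ c ≠ s.code})

theorem nearbyLength_mod {n k : ℕ} (h1 : k ≤ n + 2) (h2 : n ≤ k + 2) :
    nearbyLength n (k % 5) = k := by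
  unfold nearbyLength
  split_ifs <;> omega

theorem code_bit {s : BitPrefix} {j : ℕ} (h1 : j < s.len) (h2 : s.len ≤ j + 5) :
    s.code.2 ⟨j % 5, Nat.mod_lt _ (by norm_num)⟩ = s.bit j := by
  rw [Bool.eq_iff_iff]
  simp only [code, decide_eq_true_eq]
  refine ⟨?_, fun h => ⟨j, h1, h2, rfl, h⟩⟩
  rintro ⟨k, h3, h4, h5, h6⟩
  obtain rfl : k = j := by omega
  exact h6

theorem decode_code_len {s u : BitPrefix} (h1 : u.len ≤ s.len + 2) (h2 : s.len ≤ u.len + 2) :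
    (decode s.len u.code).len = u.len :=
  nearbyLength_mod h1 h2

theorem decode_code_bit {n j : ℕ} {u : BitPrefix} (h1 : j < u.len) (h2 : u.len ≤ j + 5) :
    (decode n u.code).bit j = u.bit j :=
  code_bit h1 h2

theorem len_eq_of_code_eq {s u : BitPrefix} (h1 : u.len ≤ s.len + 2) (h2 : s.len ≤ u.len + 2)
    (h : u.code = s.code) : u.len = s.len := by
  have : u.len % 5 = s.len % 5 := congrArg (fun c : Code => (c.1 : ℕ)) h
  omega

/-- A transmitting node is deaf, so it may miss neighbours that announce its own code. These have
its length and last bit, hence cannot trigger a pop, a raise or an extension, nor block an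
extension. -/
theorem last_bit_eq_of_code_eq {s u : BitPrefix} (h1 : u.len ≤ s.len + 2)
    (h2 : s.len ≤ u.len + 2) (h : u.code = s.code) (hs : 1 ≤ s.len) :
    u.bit (s.len - 1) = s.bit (s.len - 1) := by
  have hl := len_eq_of_code_eq h1 h2 h
  rw [← code_bit (s := u) (by omega) (by omega), ← code_bit (s := s) (by omega) (by omega), h]

open Classical in
theorem advance_congr {a : ℕ → Bool} {s : BitPrefix} {N N' : Set BitPrefix}
    (h1 : s.MustPop N ↔ s.MustPop N') (h2 : s.MustRaise N ↔ s.MustRaise N')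
    (h3 : s.MayExtend a N ↔ s.MayExtend a N') (h4 : s.NextBit a N ↔ s.NextBit a N') :
    s.advance a N = s.advance a N' := by
  have h5 : decide (s.NextBit a N) = decide (s.NextBit a N') := decide_eq_decide.2 h4
  unfold advance
  rw [h5]
  exact if_congr h1 rfl (if_congr h2 rfl (if_congr h3 rfl rfl))

/-- The codes of the neighbours, other than the node's own, carry all the information that a step
needs, if the lengths of neighbouring estimates differ by at most `2`. -/
theorem advanceHeard_eq (a : ℕ → Bool) {s : BitPrefix} {N : Set BitPrefix} {O : Set Code}
    (hN : ∀ u ∈ N, u.len ≤ s.len + 2 ∧ s.len ≤ u.len + 2)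
    (hO : ∀ c, c ≠ s.code → (c ∈ O ↔ c ∈ code '' N)) :
    s.advanceHeard a O = s.advance a N := by
  have hset : {c | c ∈ O ∧ c ≠ s.code} = code '' {u | u ∈ N ∧ u.code ≠ s.code} := by
    ext c
    constructor
    · rintro ⟨hc, hne⟩
      obtain ⟨u, hu, rfl⟩ := (hO c hne).1 hc
      exact ⟨u, ⟨hu, hne⟩, rfl⟩
    · rintro ⟨u, ⟨hu, hne⟩, rfl⟩
      exact ⟨(hO _ hne).2 ⟨u, hu, rfl⟩, hne⟩
  rw [advanceHeard, hset]
  refine advance_congr ?_ ?_ ?_ ?_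
  · simp only [MustPop, Set.exists_mem_image]
    refine exists_congr fun u => ⟨?_, ?_⟩
    · rintro ⟨⟨hu, hne⟩, h⟩
      obtain ⟨h1, h2⟩ := hN u hu
      rw [decode_code_len h1 h2] at h
      refine ⟨hu, h.imp_right ?_⟩
      rintro ⟨h3, h4, h5, h6⟩
      rw [decode_code_bit (by omega) (by omega)] at h5
      exact ⟨h3, h4, h5, h6⟩
    · rintro ⟨hu, h⟩
      obtain ⟨h1, h2⟩ := hN u hu
      refine ⟨⟨hu, fun he => ?_⟩, ?_⟩
      · have := len_eq_of_code_eq h1 h2 he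
        omega
      · rw [decode_code_len h1 h2]
        refine h.imp_right ?_
        rintro ⟨h3, h4, h5, h6⟩
        refine ⟨h3, h4, ?_, h6⟩
        rwa [decode_code_bit (by omega) (by omega)]
  · simp only [MustRaise, Set.exists_mem_image]
    refine and_congr_right fun h0 => and_congr_right fun hb => exists_congr fun u => ⟨?_, ?_⟩
    · rintro ⟨⟨hu, hne⟩, h, h'⟩
      obtain ⟨h1, h2⟩ := hN u hu
      rw [decode_code_len h1 h2] at h
      rw [decode_code_bit (by omega) (by omega)] at h'
      exact ⟨hu, h, h'⟩
    · rintro ⟨hu, h, h'⟩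
      obtain ⟨h1, h2⟩ := hN u hu
      refine ⟨⟨hu, fun he => ?_⟩, ?_, ?_⟩
      · rw [last_bit_eq_of_code_eq h1 h2 he h0, hb] at h'
        exact absurd h' (by simp)
      · rwa [decode_code_len h1 h2]
      · rwa [decode_code_bit (by omega) (by omega)]
  · simp only [MayExtend, Set.exists_mem_image, Set.forall_mem_image]
    refine and_congr ⟨fun h u hu => ?_, fun h u hu => ?_⟩ (or_congr_right ?_)
    · obtain ⟨h1, h2⟩ := hN u hu
      -- A neighbour with the same code is absent from the heard set, but satisfies the condition
      -- anyway.
      by_cases he : u.code = s.code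
      · exact ⟨(len_eq_of_code_eq h1 h2 he).ge, last_bit_eq_of_code_eq h1 h2 he⟩
      · have h3 := h ⟨hu, he⟩
        rw [decode_code_len h1 h2] at h3
        refine ⟨h3.1, fun h0 => ?_⟩
        rw [← h3.2 h0, decode_code_bit (by omega) (by omega)]
    · obtain ⟨h1, h2⟩ := hN u hu.1
      have h3 := h u hu.1
      rw [decode_code_len h1 h2]
      refine ⟨h3.1, fun h0 => ?_⟩
      rw [← h3.2 h0, decode_code_bit (by omega) (by omega)]
    · refine exists_congr fun u => ⟨?_, ?_⟩
      · rintro ⟨⟨hu, hne⟩, h⟩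
        obtain ⟨h1, h2⟩ := hN u hu
        rw [decode_code_len h1 h2] at h
        exact ⟨hu, h⟩
      · rintro ⟨hu, h⟩
        obtain ⟨h1, h2⟩ := hN u hu
        refine ⟨⟨hu, fun he => ?_⟩, ?_⟩
        · have := len_eq_of_code_eq h1 h2 he
          omega
        · rwa [decode_code_len h1 h2]
  · simp only [NextBit, Set.exists_mem_image]
    refine or_congr_right (exists_congr fun u => ⟨?_, ?_⟩)
    · rintro ⟨⟨hu, hne⟩, h, h'⟩
      obtain ⟨h1, h2⟩ := hN u hu
      rw [decode_code_len h1 h2] at h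
      rw [decode_code_bit (by omega) (by omega)] at h'
      exact ⟨hu, h, h'⟩
    · rintro ⟨hu, h, h'⟩
      obtain ⟨h1, h2⟩ := hN u hu
      refine ⟨⟨hu, fun he => ?_⟩, ?_, ?_⟩
      · have := len_eq_of_code_eq h1 h2 he
        omega
      · rwa [decode_code_len h1 h2]
      · rwa [decode_code_bit (by omega) (by omega)]

end BitPrefix

/-! ### Wake-up times as distances to the initially awake set. -/

section WakeTime

variable {V : Type}

/-- The distance of a node to the set `W` of the nodes that are awake at the beginning. -/
noncomputable def wakeTime (G : SimpleGraph V) (W : Set V) (v : V) : ℕ :=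
  sInf ((fun w => G.dist v w) '' W)

variable {G : SimpleGraph V} {W : Set V}

theorem wakeTime_le {w : V} (hw : w ∈ W) (v : V) : wakeTime G W v ≤ G.dist v w :=
  Nat.sInf_le ⟨w, hw, rfl⟩

theorem exists_dist_eq_wakeTime (hW : W.Nonempty) (v : V) :
    ∃ w ∈ W, G.dist v w = wakeTime G W v :=
  Nat.sInf_mem (hW.image _)

theorem wakeTime_eq_zero_iff (hG : G.Connected) (hW : W.Nonempty) {v : V} :
    wakeTime G W v = 0 ↔ v ∈ W := by
  constructor
  · intro h
    obtain ⟨w, hw, hd⟩ := exists_dist_eq_wakeTime (G := G) hW v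
    rw [h, hG.dist_eq_zero_iff] at hd
    rwa [hd]
  · intro h
    simpa using wakeTime_le (G := G) h v

theorem wakeTime_le_of_adj (hG : G.Connected) (hW : W.Nonempty) {u v : V} (h : G.Adj u v) :
    wakeTime G W u ≤ wakeTime G W v + 1 := by
  obtain ⟨w, hw, hd⟩ := exists_dist_eq_wakeTime (G := G) hW v
  have h1 := wakeTime_le (G := G) hw u
  have h2 := hG.dist_triangle (u := u) (v := v) (w := w)
  rw [SimpleGraph.dist_eq_one_iff_adj.2 h] at h2
  omega

theorem exists_adj_wakeTime (hW : W.Nonempty) (hG : G.Connected) {v : V}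
    (hv : 0 < wakeTime G W v) : ∃ u, G.Adj v u ∧ wakeTime G W u + 1 = wakeTime G W v := by
  obtain ⟨w, hw, hd⟩ := exists_dist_eq_wakeTime (G := G) hW v
  obtain ⟨u, hu, hdu⟩ := hG.exists_adj_dist_add_one_eq (hd ▸ hv)
  have h1 := wakeTime_le (G := G) hw u
  have h2 := wakeTime_le_of_adj hG hW hu
  exact ⟨u, hu, by omega⟩

end WakeTime

/-! ### Slots, local clocks and the protocol. -/

/-- The number of codes, that is, of virtual rounds in a slot. -/
def slotLength : ℕ := Fintype.card Code

/-- The virtual round of a slot in which the code `c` is announced. -/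
noncomputable def codeIndex (c : Code) : ℕ := Fintype.equivFin Code c

theorem codeIndex_lt (c : Code) : codeIndex c < slotLength := (Fintype.equivFin Code c).isLt

theorem codeIndex_injective : Function.Injective codeIndex := fun _ _ h =>
  (Fintype.equivFin Code).injective (Fin.ext h)

/-- The local clock at the beginning of the virtual round in which the code `c` is announced in slot
`s`. A virtual round has three rounds, since the clocks of neighbours may differ by one. -/
noncomputable def announceTime (s : ℕ) (c : Code) : ℕ := 3 + 3 * (slotLength * s + codeIndex c)

theorem announceTime_inj {s s' : ℕ} {c c' : Code} {r r' : ℕ} (hr : r < 3) (hr' : r' < 3)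
    (h : announceTime s c + r = announceTime s' c' + r') : s = s' ∧ c = c' := by
  have h1 : slotLength * s + codeIndex c = slotLength * s' + codeIndex c' := by
    unfold announceTime at h
    omega
  have hc := codeIndex_lt c
  have hc' := codeIndex_lt c'
  have hs : s = s' := by
    have := congrArg (· / slotLength) h1
    simpa [Nat.mul_add_div (Nat.zero_lt_of_lt hc), Nat.div_eq_of_lt hc, Nat.div_eq_of_lt hc']
      using this
  subst hs
  exact ⟨rfl, codeIndex_injective (by omega)⟩

theorem announceTime_ge (s : ℕ) (c : Code) : 3 + 3 * (slotLength * s) ≤ announceTime s c := by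
  unfold announceTime
  omega

theorem announceTime_lt (s : ℕ) (c : Code) :
    announceTime s c + 2 < 3 + 3 * (slotLength * (s + 1)) := by
  have := codeIndex_lt c
  unfold announceTime
  rw [Nat.mul_succ]
  omega

/-- The codes heard in slot `s`, when `h` tells in which rounds of the local clock something was
heard. -/
def heardCodes (h : ℕ → Bool) (s : ℕ) : Set Code :=
  {c | ∃ r < 3, h (announceTime s c + r) = true}

/-- The estimate of a node with identifier `a` at the beginning of slot `s`, computed from what it
has heard. -/
noncomputable def replay (a : ℕ → Bool) (h : ℕ → Bool) : ℕ → BitPrefix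
  | 0 => ⟨0, fun _ => false⟩
  | s + 1 => (replay a h s).advanceHeard a (heardCodes h s)

/-- Causality: the estimate depends only on what was heard before the slot begins. This allows the
truncated record in a node's state to be replaced by the full record of the execution. -/
theorem replay_congr (a : ℕ → Bool) {h h' : ℕ → Bool} (s : ℕ)
    (hh : ∀ k < 3 + 3 * (slotLength * s), h k = h' k) : replay a h s = replay a h' s := by
  induction s with
  | zero => rfl
  | succ s ih =>
    rw [replay, replay, ih fun k hk => hh k (by rw [Nat.mul_succ]; omega)]
    congr 1
    ext c
    refine exists_congr fun r => and_congr_right fun hr => ?_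
    have := announceTime_lt s c
    rw [hh _ (by omega)]

/-- Whether a node transmits when its local clock shows `k`: it wakes up its neighbours in its first
round, and later announces the code of its estimate once in every slot. -/
def TransmitsAt (a : ℕ → Bool) (h : ℕ → Bool) (k : ℕ) : Prop :=
  k = 0 ∨ ∃ s, k = announceTime s (replay a h s).code + 1

theorem transmitsAt_congr (a : ℕ → Bool) {h h' : ℕ → Bool} {k : ℕ} (hh : ∀ j < k, h j = h' j) :
    TransmitsAt a h k ↔ TransmitsAt a h' k := by
  refine or_congr_right (exists_congr fun s => ?_)
  have aux : ∀ {f f' : ℕ → Bool}, (∀ j < k, f j = f' j) →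
      k = announceTime s (replay a f s).code + 1 → k = announceTime s (replay a f' s).code + 1 := by
    intro f f' hf hk
    have := announceTime_ge s (replay a f s).code
    rwa [← replay_congr a s fun j hj => hf j (by omega)]
  exact ⟨aux hh, aux fun j hj => (hh j hj).symm⟩

/-- An identifier as an infinite sequence of bits. -/
def idBits {b : ℕ} (i : Fin b → Bool) (j : ℕ) : Bool := if h : j < b then i ⟨j, h⟩ else false

open Classical in
/-- The leader election protocol: `p` is the packet that is sent in order to make a noise, and the
identifier found is output after `R` slots. The state consists of the seed, the local clock, and the
record of the rounds in which something was heard. -/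
noncomputable def electionProtocol (m : Medium) (p : m.Packet) (b r R : ℕ) : Protocol m b r where
  State := Seed b r × ℕ × (ℕ → Bool)
  start := fun σ => (σ, 0, fun _ => false)
  wake := fun σ _ => (σ, 0, fun _ => false)
  transmit := fun s => if TransmitsAt (idBits s.1.1) s.2.2 s.2.1 then some p else none
  next := fun s o => (s.1, s.2.1 + 1, Function.update s.2.2 s.2.1 (m.wakes o))
  output := fun s =>
    if 3 + 3 * (slotLength * R) ≤ s.2.1 then
      some fun i => (replay (idBits s.1.1) s.2.2 R).bit i
    else none

/-- In the medium, a node can tell exactly whether it is silent and some neighbour transmits. -/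
def Medium.DetectsNoise (m : Medium) : Prop :=
  ∀ {V : Type} [Fintype V] (G : SimpleGraph V) (x : V → Option m.Packet) (v : V),
    m.wakes (m.observe G x v) = true ↔ x v = none ∧ ∃ u, G.Adj v u ∧ x u ≠ none

namespace Protocol

variable {m : Medium} {b r : ℕ} {V : Type} [Fintype V] {P : Protocol m b r} {G : SimpleGraph V}
  {W : Set V} {ω : V → Seed b r} {t : ℕ} {v : V}

theorem config_succ_of_some {s : P.State} (h : P.config G W ω t v = some s) :
    P.config G W ω (t + 1) v =
      some (P.next s (m.observe G (fun u => (P.config G W ω t u).bind P.transmit) v)) := by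
  simp only [config, h]

theorem config_succ_of_wakes (h : P.config G W ω t v = none)
    (hw : m.wakes (m.observe G (fun u => (P.config G W ω t u).bind P.transmit) v) = true) :
    P.config G W ω (t + 1) v =
      some (P.wake (ω v) (m.observe G (fun u => (P.config G W ω t u).bind P.transmit) v)) := by
  simp only [config, h, hw, if_true]

theorem config_succ_of_not_wakes (h : P.config G W ω t v = none)
    (hw : ¬ m.wakes (m.observe G (fun u => (P.config G W ω t u).bind P.transmit) v) = true) :
    P.config G W ω (t + 1) v = none := by
  simp only [config, h, hw]
  rfl

end Protocol

/-! ### The execution simulates the synchronous process. -/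

section Execution

variable {m : Medium} {p : m.Packet} {b r R : ℕ} {V : Type} [Fintype V] {G : SimpleGraph V}
  {W : Set V} {ω : V → Seed b r}

/-- What the nodes transmit in round `t`. -/
noncomputable def transmission (p : m.Packet) (R : ℕ) (G : SimpleGraph V) (W : Set V)
    (ω : V → Seed b r) (t : ℕ) (u : V) : Option m.Packet :=
  ((electionProtocol m p b r R).config G W ω t u).bind (electionProtocol m p b r R).transmit

/-- Whether `v` hears something when its local clock shows `k`. -/
noncomputable def hearing (p : m.Packet) (R : ℕ) (G : SimpleGraph V) (W : Set V)
    (ω : V → Seed b r) (v : V) (k : ℕ) : Bool :=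
  m.wakes (m.observe G (transmission p R G W ω (k + wakeTime G W v)) v)

/-- The record `h` up to time `k`. -/
def truncate (h : ℕ → Bool) (k : ℕ) (j : ℕ) : Bool := if j < k then h j else false

theorem update_truncate (h : ℕ → Bool) (k : ℕ) :
    Function.update (truncate h k) k (h k) = truncate h (k + 1) := by
  funext j
  rcases lt_trichotomy j k with hj | rfl | hj
  · rw [Function.update_of_ne hj.ne, truncate, truncate, if_pos hj, if_pos (by omega)]
  · simp [truncate]
  · rw [Function.update_of_ne hj.ne', truncate, truncate, if_neg (by omega), if_neg (by omega)]

/-- The state of `v` when its local clock shows `k`. -/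
noncomputable def stateAt (p : m.Packet) (R : ℕ) (G : SimpleGraph V) (W : Set V)
    (ω : V → Seed b r) (v : V) (k : ℕ) : (electionProtocol m p b r R).State :=
  (ω v, k, truncate (hearing p R G W ω v) k)

theorem output_stateAt (v : V) (k : ℕ) :
    (electionProtocol m p b r R).output (stateAt p R G W ω v k) =
      if 3 + 3 * (slotLength * R) ≤ k then
        some fun i : Fin b => (replay (idBits (ω v).1) (truncate (hearing p R G W ω v) k) R).bit i
      else none := by
  dsimp only [electionProtocol, stateAt]

/-- The node `v` is awake from round `wakeTime G W v` on. -/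
theorem config_eq (hm : m.DetectsNoise) (hG : G.Connected) (hW : W.Nonempty) (t : ℕ) (v : V) :
    (electionProtocol m p b r R).config G W ω t v =
      if wakeTime G W v ≤ t then some (stateAt p R G W ω v (t - wakeTime G W v)) else none := by
  induction t generalizing v with
  | zero =>
    rw [Protocol.config]
    by_cases h : v ∈ W
    · rw [if_pos h, if_pos ((wakeTime_eq_zero_iff hG hW).2 h).le, Nat.zero_sub]
      rfl
    · rw [if_neg h, if_neg fun h0 => h ((wakeTime_eq_zero_iff hG hW).1 (Nat.le_zero.1 h0))]
  | succ t ih =>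
    rcases Nat.lt_trichotomy (wakeTime G W v) (t + 1) with hlt | heq | hgt
    · rw [Protocol.config_succ_of_some ((ih v).trans (if_pos (by omega))), if_pos (by omega)]
      have hhear : m.wakes (m.observe G (transmission p R G W ω t) v) =
          hearing p R G W ω v (t - wakeTime G W v) := by
        rw [hearing, Nat.sub_add_cancel (by omega)]
      have hstate : stateAt p R G W ω v (t - wakeTime G W v + 1) =
          (electionProtocol m p b r R).next (stateAt p R G W ω v (t - wakeTime G W v))
            (m.observe G (transmission p R G W ω t) v) := by
        change (ω v, t - wakeTime G W v + 1,
          truncate (hearing p R G W ω v) (t - wakeTime G W v + 1)) = (ω v, t - wakeTime G W v + 1,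
          Function.update (truncate (hearing p R G W ω v) (t - wakeTime G W v))
            (t - wakeTime G W v) (m.wakes (m.observe G (transmission p R G W ω t) v)))
        rw [hhear, update_truncate]
      rw [Nat.sub_add_comm (by omega), hstate]
      rfl
    -- A neighbour one step closer to `W` has clock 0 in round `t` and sends its wake-up signal.
    · have hwake : m.wakes (m.observe G (transmission p R G W ω t) v) = true := by
        rw [hm]
        obtain ⟨u, hu, hdu⟩ := exists_adj_wakeTime (G := G) hW hG (v := v) (by omega)
        refine ⟨by rw [transmission, ih v, if_neg (by omega)]; rfl, u, hu, ?_⟩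
        rw [transmission, ih u, if_pos (by omega), show t - wakeTime G W u = 0 by omega]
        simp [electionProtocol, stateAt, TransmitsAt]
      rw [Protocol.config_succ_of_wakes ((ih v).trans (if_neg (by omega))) hwake,
        if_pos (by omega), heq, Nat.sub_self]
      rfl
    · have hwake : ¬ m.wakes (m.observe G (transmission p R G W ω t) v) = true := by
        rw [hm]
        rintro ⟨_, u, hu, hne⟩
        have := wakeTime_le_of_adj hG hW hu
        rw [transmission, ih u, if_neg (by omega)] at hne
        exact hne rfl
      rw [Protocol.config_succ_of_not_wakes ((ih v).trans (if_neg (by omega))) hwake,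
        if_neg (by omega)]

theorem transmission_ne_none_iff (hm : m.DetectsNoise) (hG : G.Connected) (hW : W.Nonempty)
    (t : ℕ) (v : V) : transmission p R G W ω t v ≠ none ↔ wakeTime G W v ≤ t ∧
      TransmitsAt (idBits (ω v).1) (hearing p R G W ω v) (t - wakeTime G W v) := by
  rw [transmission, config_eq hm hG hW]
  by_cases h : wakeTime G W v ≤ t
  · rw [if_pos h, transmitsAt_congr (h' := truncate (hearing p R G W ω v) (t - wakeTime G W v))
      _ fun j hj => by rw [truncate, if_pos hj]]
    simp [electionProtocol, stateAt, h]
  · rw [if_neg h]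
    exact iff_of_false (fun hne => hne rfl) fun h' => h h'.1

/-- This eliminates the states: only records and clock offsets remain. The last argument is the
clock of `u` when that of `v` shows `k`. -/
theorem hearing_eq_true_iff (hm : m.DetectsNoise) (hG : G.Connected) (hW : W.Nonempty)
    (v : V) (k : ℕ) : hearing p R G W ω v k = true ↔
      ¬ TransmitsAt (idBits (ω v).1) (hearing p R G W ω v) k ∧
      ∃ u, G.Adj v u ∧ wakeTime G W u ≤ k + wakeTime G W v ∧
        TransmitsAt (idBits (ω u).1) (hearing p R G W ω u)
          (k + wakeTime G W v - wakeTime G W u) := by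
  rw [hearing, hm, ← not_ne_iff (a := transmission p R G W ω (k + wakeTime G W v) v)]
  simp only [transmission_ne_none_iff hm hG hW, Nat.le_add_left, Nat.add_sub_cancel, true_and]

/-- The protocol simulates the synchronous process. -/
theorem replay_hearing (hm : m.DetectsNoise) (hG : G.Connected) (hW : W.Nonempty)
    {M : ℕ → Bool} (hM : IsLexUpperBound (fun v => idBits (ω v).1) M) (s : ℕ) (v : V) :
    replay (idBits (ω v).1) (hearing p R G W ω v) s =
      estimate G (fun v => idBits (ω v).1) s v := by
  induction s generalizing v with
  | zero => rfl
  | succ s ih =>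
    have hlip := (coherent_estimate G hM s).lipschitz
    rw [replay, estimate, advanceAll, ih v]
    refine advanceHeard_eq _ ?_ fun c hc => ?_
    · rintro _ ⟨u, hu, rfl⟩
      exact ⟨hlip u v (SimpleGraph.Adj.symm hu), hlip v u hu⟩
    have h3 := announceTime_ge s c
    constructor
    · rintro ⟨r, hr, hh⟩
      obtain ⟨_, u, hu, _, hT⟩ := (hearing_eq_true_iff hm hG hW v _).1 hh
      have d1 := wakeTime_le_of_adj hG hW hu
      have d2 := wakeTime_le_of_adj hG hW hu.symm
      -- A wake-up signal is heard when the clock of `v` shows at most 1, whereas announcements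
      -- start at 3.
      rcases hT with hT | ⟨s', hT⟩
      · omega
      generalize hc' : (replay (idBits (ω u).1) (hearing p R G W ω u) s').code = c' at hT
      obtain ⟨rfl, rfl⟩ : s = s' ∧ c = c' := by
        -- The two announcement times differ by at most 2 and are multiples of 3, hence equal.
        have hmod : announceTime s c % 3 = 0 := by unfold announceTime; omega
        have hmod' : announceTime s' c' % 3 = 0 := by unfold announceTime; omega
        exact announceTime_inj (r := 0) (r' := 0) (by omega) (by omega) (by omega)
      rw [ih u] at hc'
      exact ⟨_, ⟨u, hu, rfl⟩, hc'⟩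
    · rintro ⟨_, ⟨u, hu, rfl⟩, rfl⟩
      have d1 := wakeTime_le_of_adj hG hW hu
      have d2 := wakeTime_le_of_adj hG hW hu.symm
      -- The neighbour transmits in the middle round on its own clock; the offset of the clocks
      -- moves this to round 0, 1 or 2 for `v`.
      refine ⟨1 + wakeTime G W u - wakeTime G W v, by omega,
        (hearing_eq_true_iff hm hG hW v _).2 ⟨?_, u, hu, by omega, Or.inr ⟨s, ?_⟩⟩⟩
      · rintro (hT | ⟨s', hT⟩)
        · omega
        · obtain ⟨rfl, he⟩ := announceTime_inj (by omega) (by omega) hT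
          rw [ih v] at he
          exact hc he
      · rw [ih u]
        omega

end Execution

/-! ### Correctness for distinct identifiers. -/

theorem exists_isLexUpperBound {V : Type} [Finite V] [Nonempty V] (a : V → ℕ → Bool) :
    ∃ l, IsLexUpperBound a (a l) := by
  obtain ⟨l, hl⟩ := Finite.exists_max fun v => toLex (a v)
  refine ⟨l, fun v i hpre hv => ?_⟩
  by_contra hi
  refine absurd (hl v) (not_le.2 ⟨i, fun j hj => (hpre j hj).symm, ?_⟩)
  change a l i < a v i
  rw [hv, Bool.eq_false_of_not_eq_true hi]
  exact Bool.false_lt_true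

/-- If the identifiers are distinct, then the protocol elects a leader, provided that the number `R`
of slots is sufficient for the process to converge. -/
theorem electionProtocol_electsLeaderBy {m : Medium} (p : m.Packet) {b r R : ℕ} {V : Type}
    [Fintype V] {G : SimpleGraph V} {W : Set V} {ω : V → Seed b r} {T : ℝ}
    (hm : m.DetectsNoise) (hG : G.Connected) (hW : W.Nonempty)
    (hω : Function.Injective fun v => (ω v).1) (hR : 3 * b + 2 * G.diam < R)
    (hT : ((3 + 3 * (slotLength * R) + G.diam : ℕ) : ℝ) ≤ T) :
    (electionProtocol m p b r R).ElectsLeaderBy G W ω T := by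
  have := hG.nonempty
  have hdist : ∀ u v, G.dist u v ≤ G.diam := fun u v =>
    SimpleGraph.dist_le_diam (SimpleGraph.connected_iff_ediam_ne_top.1 hG)
  obtain ⟨l, hl⟩ := exists_isLexUpperBound fun v => idBits (ω v).1
  have hout : ∀ t v, (electionProtocol m p b r R).outputAt G W ω t v =
      if wakeTime G W v ≤ t ∧ 3 + 3 * (slotLength * R) ≤ t - wakeTime G W v then
        some (ω l).1 else none := by
    intro t v
    rw [Protocol.outputAt, config_eq hm hG hW]
    by_cases h1 : wakeTime G W v ≤ t
    swap
    · rw [if_neg h1, if_neg fun h => h1 h.1]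
      rfl
    rw [if_pos h1, Option.bind_some, output_stateAt]
    by_cases h2 : 3 + 3 * (slotLength * R) ≤ t - wakeTime G W v
    swap
    · rw [if_neg h2, if_neg fun h => h2 h.2]
    rw [if_pos h2, if_pos ⟨h1, h2⟩, replay_congr (h' := hearing p R G W ω v) _ _ fun k hk => by
      rw [truncate, if_pos (by omega)], replay_hearing hm hG hW hl]
    have hd := hdist l v
    -- The number of slots exceeds the deadline for `b` bits, so the other alternative fails.
    -- Estimates may grow beyond `b` along the zero padding of `idBits`; only the first `b` bits are
    -- output.
    have hag := (agrees_or_short hG hl rfl R v b).resolve_right (by omega)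
    congr 1
    funext i
    rw [hag.2 i i.isLt, idBits, dif_pos i.isLt]
  refine ⟨l, fun v hv => hω hv, fun t v i hi => ?_, fun t v ht => ?_⟩
  · rw [hout] at hi
    split_ifs at hi
    exact (Option.some.inj hi).symm
  · have ht' : 3 + 3 * (slotLength * R) + G.diam ≤ t := by exact_mod_cast hT.trans ht
    obtain ⟨w, hw⟩ := hW
    have h1 := wakeTime_le (G := G) hw v
    have h2 := hdist v w
    rw [hout, if_pos ⟨by omega, by omega⟩]

/-! ### The two media, and the probability of distinct identifiers. -/

theorem beepMedium_detectsNoise : beepMedium.DetectsNoise := by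
  intro V _ G x v
  simp [beepMedium]

theorem radioMedium_detectsNoise (k : ℕ) : (radioMedium k).DetectsNoise := by
  classical
  intro V _ G x v
  change RadioObs.wakes (if x v = none then _ else _) = true ↔ _
  by_cases hv : x v = none
  · rw [if_pos hv]
    have hnil : (G.neighborFinset v).toList.filterMap x ≠ [] ↔ ∃ u, G.Adj v u ∧ x u ≠ none := by
      rw [Ne, List.filterMap_eq_nil_iff]
      simp
    have hwakes : ∀ L : List (Fin k → Bool), RadioObs.wakes (match L with
        | [] => .silence
        | [p] => .packet p
        | _ => .collision) = true ↔ L ≠ [] := by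
      rintro (_ | ⟨p, _ | ⟨p', L⟩⟩) <;> simp [RadioObs.wakes]
    simp only [hv, true_and]
    exact (hwakes _).trans hnil
  · rw [if_neg hv]
    simp [RadioObs.wakes, hv]

theorem uniformProb_mono {Ω : Type} [Fintype Ω] {E F : Ω → Prop} (h : ∀ x, E x → F x) :
    uniformProb E ≤ uniformProb F := by
  unfold uniformProb
  gcongr with x
  exact h x

/-- A lower bound for the probability that uniformly random values are distinct. -/
theorem le_uniformProb_injective (V S : Type) [Fintype V] [DecidableEq V] [Fintype S]
    [Nonempty S] :
    1 - (Fintype.card V : ℝ) ^ 2 / (Fintype.card S : ℝ) ≤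
      uniformProb (fun ω : V → S => Function.Injective ω) := by
  classical
  have hcard : (Finset.univ.filter fun ω : V → S => Function.Injective ω).card =
      (Fintype.card S).descFactorial (Fintype.card V) := by
    rw [← Fintype.card_embedding_eq, ← Fintype.card_subtype]
    exact Fintype.card_congr (Equiv.subtypeInjectiveEquivEmbedding V S)
  have hS : 0 < Fintype.card S := Fintype.card_pos
  have hu : uniformProb (fun ω : V → S => Function.Injective ω) =
      ((Fintype.card S).descFactorial (Fintype.card V) : ℝ) /
        (Fintype.card S : ℝ) ^ Fintype.card V := by
    rw [uniformProb, ← hcard, Fintype.card_fun, Nat.cast_pow]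
    congr!
  rw [hu]
  generalize Fintype.card S = K at *
  generalize Fintype.card V = n at *
  have hK : (0 : ℝ) < K := by exact_mod_cast hS
  rcases Nat.lt_or_ge K n with hlt | hge
  · refine le_trans ?_ (by positivity : (0 : ℝ) ≤ _)
    rw [sub_nonpos, one_le_div hK]
    have h1 : (K : ℝ) ≤ n := by exact_mod_cast hlt.le
    have h2 : (1 : ℝ) ≤ n := by exact_mod_cast (by omega : 1 ≤ n)
    nlinarith
  · have hn : (n : ℝ) ≤ K := by exact_mod_cast hge
    have hq : (n : ℝ) / K ≤ 1 := (div_le_one hK).2 hn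
    -- Bernoulli's inequality, followed by the bound of each of the `n` factors of the falling
    -- factorial from below by `K - n`.
    calc 1 - (n : ℝ) ^ 2 / K = 1 + n * (-((n : ℝ) / K)) := by ring
      _ ≤ (1 + -((n : ℝ) / K)) ^ n := one_add_mul_le_pow (by linarith) n
      _ = ((K : ℝ) - n) ^ n / (K : ℝ) ^ n := by
        rw [← div_pow]
        congr 1
        field_simp
        ring
      _ ≤ (K.descFactorial n : ℝ) / (K : ℝ) ^ n := by
        gcongr
        have h1 : ((K + 1 - n : ℕ) : ℝ) ^ n ≤ (K.descFactorial n : ℝ) := by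
          exact_mod_cast Nat.pow_sub_le_descFactorial K n
        refine le_trans (pow_le_pow_left₀ (by linarith) ?_ n) h1
        rw [Nat.cast_sub (by omega)]
        push_cast
        linarith

/-! ### Running time and choice of constants. -/

theorem one_le_lg (x : ℝ) : 1 ≤ lg x := le_max_left _ _

theorem add_lg_le_electionTime (n D : ℕ) : (D : ℝ) + lg n ≤ electionTime n D := by
  have h1 := one_le_lg n
  have h2 := one_le_lg (lg n)
  have h3 : 1 ≤ min (lg (lg n)) (lg ((n : ℝ) / D)) := le_min h2 (one_le_lg _)
  have h4 : (D : ℝ) + lg n ≤ D + lg n * lg (lg n) := by nlinarith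
  have h5 : (0 : ℝ) ≤ D + lg n * lg (lg n) := by positivity
  unfold electionTime
  nlinarith

theorem log_add_one_le_lg {κ n N : ℕ} (hn : 1 ≤ n) (hN : N ≠ 0) (h : N ≤ κ * n) :
    ((Nat.log 2 N + 1 : ℕ) : ℝ) ≤ (κ + 2) * lg n := by
  have h1 : (2 : ℝ) ^ Nat.log 2 N ≤ 2 ^ κ * n := by
    have : 2 ^ Nat.log 2 N ≤ 2 ^ κ * n :=
      (Nat.pow_log_le_self 2 hN).trans (h.trans (Nat.mul_le_mul_right _ Nat.lt_two_pow_self.le))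
    exact_mod_cast this
  have hn' : (0 : ℝ) < n := by exact_mod_cast hn
  have h2 := Real.logb_le_logb_of_le (b := 2) (by norm_num) (by positivity) h1
  rw [Real.logb_mul (by positivity) hn'.ne', Real.logb_pow, Real.logb_pow,
    Real.logb_self_eq_one (by norm_num)] at h2
  have h3 : Real.logb 2 n ≤ lg n := le_max_right _ _
  have h4 := one_le_lg n
  have h5 : (0 : ℝ) ≤ κ := Nat.cast_nonneg κ
  push_cast
  nlinarith

/-- The number of bits of the identifiers, in units of `Nat.log 2 N + 1`. -/
def electionIdFactor (c κ : ℕ) : ℕ := (c + 2) * (κ + 1)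

/-- Since `κ ≤ 2 ^ κ`, the factor `κ + 1` in the identifier length absorbs the error of the
estimate. In the exponent `c + 2`, the 2 pays for the `n ^ 2` in the collision bound. -/
theorem pow_le_two_pow_idLength {c κ n N : ℕ} (h : n ≤ κ * N) :
    n ^ (c + 2) ≤ 2 ^ (electionIdFactor c κ * (Nat.log 2 N + 1)) := by
  have h1 : n ≤ 2 ^ ((κ + 1) * (Nat.log 2 N + 1)) := by
    calc n ≤ κ * N := h
      _ ≤ 2 ^ κ * 2 ^ (Nat.log 2 N + 1) :=
        Nat.mul_le_mul Nat.lt_two_pow_self.le (Nat.lt_pow_succ_log_self (by norm_num) N).le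
      _ = 2 ^ (κ + (Nat.log 2 N + 1)) := (pow_add _ _ _).symm
      _ ≤ 2 ^ ((κ + 1) * (Nat.log 2 N + 1)) :=
        Nat.pow_le_pow_right (by norm_num) (by nlinarith [Nat.zero_le (κ * Nat.log 2 N)])
  calc n ^ (c + 2) ≤ (2 ^ ((κ + 1) * (Nat.log 2 N + 1))) ^ (c + 2) := Nat.pow_le_pow_left h1 _
    _ = _ := by
      rw [← pow_mul, electionIdFactor]
      congr 1
      ring

/-- The number of slots after which the leader's identifier is output. -/
def electionSlots (c κ N Δ : ℕ) : ℕ :=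
  3 * (electionIdFactor c κ * (Nat.log 2 N + 1)) + 2 * (κ * Δ) + 1

/-- The leader election algorithm, in a medium in which `p N` is some packet. -/
noncomputable def electionAlgorithm (m : ℕ → Medium) (p : (N : ℕ) → (m N).Packet) (c κ : ℕ) :
    DistributedAlgorithm m where
  idFactor := electionIdFactor c κ
  idFactor_pos := Nat.mul_pos (Nat.succ_pos _) (Nat.succ_pos _)
  coins := fun _ _ => 0
  protocol := fun N Δ => electionProtocol (m N) (p N) _ _ (electionSlots c κ N Δ)

/-- The constant in the running time of the algorithm. -/
def electionConstant (c κ : ℕ) : ℕ :=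
  3 + 3 * slotLength * (3 * electionIdFactor c κ * (κ + 2) + 2 * κ ^ 2 + 1) + 1

theorem electionSlots_time_le {c κ n D N Δ : ℕ} (hn : 1 ≤ n) (hN : N ≠ 0) (h : N ≤ κ * n)
    (hΔ : Δ ≤ κ * D) :
    ((3 + 3 * (slotLength * electionSlots c κ N Δ) + D : ℕ) : ℝ) ≤
      electionConstant c κ * electionTime n D := by
  have h1 := log_add_one_le_lg hn hN h
  have h2 : (Δ : ℝ) ≤ κ * D := by exact_mod_cast hΔ
  have h3 := one_le_lg n
  have hD : (0 : ℝ) ≤ D := Nat.cast_nonneg D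
  have hslots : (electionSlots c κ N Δ : ℝ) ≤
      (3 * electionIdFactor c κ * (κ + 2) + 2 * κ ^ 2 + 1) * (D + lg n) := by
    have e1 : (electionIdFactor c κ : ℝ) * ((Nat.log 2 N + 1 : ℕ) : ℝ) ≤
        electionIdFactor c κ * ((κ + 2) * lg n) := by gcongr
    have e2 : (κ : ℝ) * Δ ≤ κ * (κ * D) := by gcongr
    have e3 : (0 : ℝ) ≤ electionIdFactor c κ * (κ + 2) * D := by positivity
    have e4 : (0 : ℝ) ≤ (κ : ℝ) ^ 2 * lg n := by positivity
    calc (electionSlots c κ N Δ : ℝ)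
        = 3 * (electionIdFactor c κ * ((Nat.log 2 N + 1 : ℕ) : ℝ)) + 2 * (κ * Δ) + 1 := by
          simp [electionSlots]
      _ ≤ _ := by nlinarith
  calc ((3 + 3 * (slotLength * electionSlots c κ N Δ) + D : ℕ) : ℝ)
      = 3 + 3 * (slotLength * (electionSlots c κ N Δ : ℝ)) + D := by push_cast; ring
    _ ≤ 3 + 3 * (slotLength *
        ((3 * electionIdFactor c κ * (κ + 2) + 2 * κ ^ 2 + 1) * (D + lg n))) + D := by gcongr
    _ ≤ electionConstant c κ * (D + lg n) := by
      unfold electionConstant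
      push_cast
      nlinarith
    _ ≤ electionConstant c κ * electionTime n D := by
      gcongr
      exact add_lg_le_electionTime n D

theorem electionAlgorithm_solvesLeaderElection {m : ℕ → Medium} (p : (N : ℕ) → (m N).Packet)
    (hm : ∀ N, (m N).DetectsNoise) (c κ : ℕ) :
    (electionAlgorithm m p c κ).SolvesLeaderElection c κ (electionConstant c κ) := by
  intro V _ _ G W N Δ hG hW hn hN hD hΔ
  have := hG.nonempty
  have hpos : 1 ≤ Fintype.card V := Fintype.card_pos
  have hN0 : N ≠ 0 := by
    rintro rfl
    omega
  calc 1 - 1 / (Fintype.card V : ℝ) ^ c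
      ≤ 1 - (Fintype.card V : ℝ) ^ 2 /
          (Fintype.card (Seed (electionIdFactor c κ * (Nat.log 2 N + 1)) 0) : ℝ) := by
        have hle : (Fintype.card V : ℝ) ^ (c + 2) ≤
            2 ^ (electionIdFactor c κ * (Nat.log 2 N + 1)) := by
          exact_mod_cast pow_le_two_pow_idLength (c := c) hn
        have hpos' : (0 : ℝ) < Fintype.card V := by exact_mod_cast hpos
        have hcard : (Fintype.card (Seed (electionIdFactor c κ * (Nat.log 2 N + 1)) 0) : ℝ) =
            2 ^ (electionIdFactor c κ * (Nat.log 2 N + 1)) := by simp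
        rw [hcard]
        refine sub_le_sub_left ?_ 1
        rw [div_le_div_iff₀ (by positivity) (by positivity), one_mul, ← pow_add, add_comm 2 c]
        exact hle
    _ ≤ uniformProb (fun ω : V → Seed (electionIdFactor c κ * (Nat.log 2 N + 1)) 0 =>
          Function.Injective ω) := le_uniformProb_injective V _
    _ ≤ _ := by
        refine uniformProb_mono fun ω hω => ?_
        refine electionProtocol_electsLeaderBy (p N) (hm N) hG hW (fun u v huv => hω ?_) ?_
          (electionSlots_time_le hpos hN0 hN hΔ)
        -- There are no further coins, so a seed is just an identifier.
        · exact Prod.ext huv (Subsingleton.elim _ _)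
        · rw [electionSlots]
          change 3 * (electionIdFactor c κ * (Nat.log 2 N + 1)) + _ < _
          omega

theorem theorem2 (c κ : ℕ) (hκ : 1 ≤ κ) :
    ∃ C : ℕ,
      (∃ A : DistributedAlgorithm (fun _ => beepMedium), A.SolvesLeaderElection c κ C) ∧
      (∀ k : ℕ → ℕ, ∃ A : DistributedAlgorithm (fun N => radioMedium (k N)),
        A.SolvesLeaderElection c κ C) :=
  ⟨electionConstant c κ,
    ⟨electionAlgorithm _ (fun _ => ()) c κ,
      electionAlgorithm_solvesLeaderElection _ (fun _ => beepMedium_detectsNoise) c κ⟩,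
    fun k => ⟨electionAlgorithm _ (fun _ _ => false) c κ,
      electionAlgorithm_solvesLeaderElection _ (fun N => radioMedium_detectsNoise (k N)) c κ⟩⟩
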